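/- Let $S$ be an oriented smooth closed curve in the plane, i.e. a curve given by a continuously differentiable $1$-periodic map $\gamma:\mathbb R\to\mathbb R^2$ with $\gamma'(t)\neq 0$ for all $t$. Let $R(S)\in\mathbb Z$ be its rotation number, i.e. the signed (counterclockwise positive) number of full turns made by the tangent vector $\gamma'(t)$ as $t$ runs over one period. Call $S$ normal if no parts of it overlap or touch and no three pieces meet at a common point; that is, whenever $\gamma(s)=\gamma(t)$ with $s\neq t$ in $[0,1)$ the vectors $\gamma'(s),\gamma'(t)$ are linearly independent, and no point of the plane is $\gamma(s)$ for three different $s\in[0,1)$. A self-intersection of $S$ is a point $p=\gamma(s)=\gamma(t)$ with $s\ne t$ in $[0,1)$. Lemma. If $S$ is a normal oriented smooth closed curve, then the number $I$ of self-intersections of $S$ is finite and $I\ \ge\ \bigl|\,|R(S)|-1\,\bigr|$. -/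

import Mathlib

/-- An oriented smooth closed curve in the plane (identified with `ℂ`), given by a parametrization
of period one that is continuously differentiable and has a nowhere vanishing velocity.  The
orientation is the direction of increasing parameter. -/
structure SmoothClosedCurve where
  /-- the parametrization -/
  toFun : ℝ → ℂ
  contDiff : ContDiff ℝ 1 toFun
  periodic : Function.Periodic toFun 1
  deriv_ne_zero : ∀ t, deriv toFun t ≠ 0

namespace SmoothClosedCurve

instance : CoeFun SmoothClosedCurve (fun _ => ℝ → ℂ) := ⟨SmoothClosedCurve.toFun⟩

/-- `θ` is a continuous choice of the direction angle of the tangent vector along `S`. -/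
def IsTangentAngle (S : SmoothClosedCurve) (θ : ℝ → ℝ) : Prop :=
  Continuous θ ∧ ∀ t, deriv S t = (‖deriv S t‖ : ℂ) * Complex.exp ((θ t : ℂ) * Complex.I)

theorem exists_isTangentAngle (S : SmoothClosedCurve) : ∃ θ, S.IsTangentAngle θ := by
  have hc : Continuous (deriv S) := S.contDiff.continuous_deriv le_rfl
  obtain ⟨f, hf, hfe⟩ := Complex.exists_continuousOn_eqOn_exp_comp (X := ℝ) (U := Set.univ)
    ((Homeomorph.Set.univ ℝ).toHomotopyEquiv.simplyConnectedSpace_iff.mpr inferInstance) isOpen_univ hc.continuousOn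
    (by rintro ⟨t, -, ht⟩; exact S.deriv_ne_zero t ht)
  refine ⟨fun t => (f t).im, Complex.continuous_im.comp (continuousOn_univ.mp hf), fun t => ?_⟩
  have h : deriv S t = Complex.exp (f t) := (hfe (Set.mem_univ t)).symm
  rw [h, Complex.norm_exp, Complex.ofReal_exp, ← Complex.exp_add, Complex.re_add_im]

theorem deriv_periodic (S : SmoothClosedCurve) : Function.Periodic (deriv S) 1 := by
  intro t
  rw [← deriv_comp_add_const]
  congr 1
  exact funext S.periodic

theorem IsTangentAngle.exp_eq {S : SmoothClosedCurve} {θ₁ θ₂ : ℝ → ℝ} {s t : ℝ}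
    (h₁ : S.IsTangentAngle θ₁) (h₂ : S.IsTangentAngle θ₂) (hst : deriv S s = deriv S t) :
    ∃ n : ℤ, θ₁ s - θ₂ t = 2 * Real.pi * n := by
  have e₁ := h₁.2 s
  have e₂ := h₂.2 t
  rw [hst] at e₁
  have hne : (‖deriv S t‖ : ℂ) ≠ 0 := by
    exact_mod_cast norm_ne_zero_iff.mpr (S.deriv_ne_zero t)
  obtain ⟨n, hn⟩ := Complex.exp_eq_exp_iff_exists_int.mp (mul_left_cancel₀ hne (e₁.symm.trans e₂))
  refine ⟨n, ?_⟩
  have := congrArg Complex.im hn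
  simp at this
  linarith

/-- The total turning of the tangent over one period is an integer number of full turns, and does
not depend on the choice of the direction angle. -/
theorem exists_rotationNumber (S : SmoothClosedCurve) :
    ∃ n : ℤ, ∀ θ, S.IsTangentAngle θ → θ 1 - θ 0 = 2 * Real.pi * n := by
  obtain ⟨θ₀, h₀⟩ := S.exists_isTangentAngle
  have h01 : deriv S 1 = deriv S 0 := by simpa using S.deriv_periodic 0
  obtain ⟨n, hn⟩ := h₀.exp_eq h₀ h01
  refine ⟨n, fun θ h => ?_⟩
  have hpi : (2 * Real.pi) ≠ 0 := by positivity
  have key : ∀ t, ∃ m : ℤ, (θ t - θ₀ t) / (2 * Real.pi) = m := fun t => by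
    obtain ⟨m, hm⟩ := h.exp_eq h₀ (rfl : deriv S t = deriv S t)
    exact ⟨m, by rw [hm]; field_simp⟩
  choose m hm using key
  have hmc : Continuous m := by
    refine (Int.isClosedEmbedding_coe_real.isEmbedding.continuous_iff).mpr ?_
    have : (Int.cast ∘ m : ℝ → ℝ) = fun t => (θ t - θ₀ t) / (2 * Real.pi) :=
      funext fun t => (hm t).symm
    rw [this]
    exact (h.1.sub h₀.1).div_const _
  have hm01 : m 1 = m 0 := PreconnectedSpace.constant inferInstance hmc
  have h1 := hm 1
  have h0 := hm 0
  rw [hm01, ← h0] at h1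
  field_simp at h1
  linarith

/-- The rotation number: the (signed, counterclockwise) number of full turns made by the tangent
vector while the curve is traversed once. -/
noncomputable def rotationNumber (S : SmoothClosedCurve) : ℤ := S.exists_rotationNumber.choose

theorem IsTangentAngle.sub_eq {S : SmoothClosedCurve} {θ : ℝ → ℝ} (h : S.IsTangentAngle θ) :
    θ 1 - θ 0 = 2 * Real.pi * S.rotationNumber :=
  S.exists_rotationNumber.choose_spec θ h

/-- A curve is normal if two different pieces that meet always cross, i.e. have linearly
independent tangent vectors at the common point (so no parts of the curve touch or overlap), and
no three different pieces have a common point. -/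
structure IsNormal (S : SmoothClosedCurve) : Prop where
  transverse : ∀ s ∈ Set.Ico (0 : ℝ) 1, ∀ t ∈ Set.Ico (0 : ℝ) 1, s ≠ t → S s = S t →
    LinearIndependent ℝ ![deriv S s, deriv S t]
  no_triple : ∀ s ∈ Set.Ico (0 : ℝ) 1, ∀ t ∈ Set.Ico (0 : ℝ) 1, ∀ u ∈ Set.Ico (0 : ℝ) 1,
    S s = S t → S t = S u → s = t ∨ t = u ∨ s = u

/-- The self-intersections: points of the plane through which the curve passes at two different
parameters within one period. -/
def selfIntersections (S : SmoothClosedCurve) : Set ℂ :=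
  {p | ∃ s ∈ Set.Ico (0 : ℝ) 1, ∃ t ∈ Set.Ico (0 : ℝ) 1, s ≠ t ∧ S s = p ∧ S t = p}

end SmoothClosedCurve

/-! Take a lowest point `S a` and follow the chord from `S s` to `S (s + u)` over the triangle of
parameters with `a ≤ s`, `0 ≤ u`, `s + u ≤ a + 1`. Divided by `u * (1 - u)`, the chord extends
continuously to `secant`, with value the tangent at `u = 0` and its opposite at `u = 1`. Its zeros
in the triangle correspond bijectively to the self-intersections; transversality makes them
nondegenerate, and the choice of `a` keeps them off the boundary.

The turns `n` of `secant` along the boundary are then computed in two ways. Dividing out the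
linearizations at the zeros (`exists_continuous_factor`) leaves a zero-free factor, which makes no
turn, while each linear factor makes at most one; so `|n|` is at most the number of zeros. On the
boundary, the bottom side contributes the rotation number, and each of the other two sides
contributes the same half turn, because chords from a lowest point never point downwards. Hence the
rotation number is `n + 1` or `n - 1`, which gives the bound. -/

section

/-! ### Variation of the logarithm along a path -/

open Complex Set Filter Topology

/-- `v` is the total variation of a continuous logarithm of the path `p` on the unit interval. -/
def HasLogVariation (p : ℝ → ℂ) (v : ℂ) : Prop :=
  ∃ f : ℝ → ℂ, ContinuousOn f (Icc 0 1) ∧ (∀ x ∈ Icc (0 : ℝ) 1, exp (f x) = p x) ∧ f 1 - f 0 = v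

namespace HasLogVariation

variable {p q : ℝ → ℂ} {v w : ℂ}

theorem congr (hp : HasLogVariation p v) (h : ∀ x ∈ Icc (0 : ℝ) 1, p x = q x) :
    HasLogVariation q v := by
  obtain ⟨f, hf, hfp, hv⟩ := hp
  exact ⟨f, hf, fun x hx => (hfp x hx).trans (h x hx), hv⟩

theorem mul (hp : HasLogVariation p v) (hq : HasLogVariation q w) :
    HasLogVariation (fun x => p x * q x) (v + w) := by
  obtain ⟨f, hf, hfp, rfl⟩ := hp
  obtain ⟨g, hg, hgq, rfl⟩ := hq
  refine ⟨fun x => f x + g x, hf.add hg, fun x hx => ?_, by ring⟩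
  rw [exp_add, hfp x hx, hgq x hx]

theorem const_mul {c : ℂ} (hc : c ≠ 0) (hp : HasLogVariation p v) :
    HasLogVariation (fun x => c * p x) v := by
  have h : HasLogVariation (fun _ => c) 0 :=
    ⟨fun _ => log c, continuousOn_const, fun _ _ => exp_log hc, by simp⟩
  simpa using h.mul hp

theorem exp_eq_div (hp : HasLogVariation p v) : exp v = p 1 / p 0 := by
  obtain ⟨f, -, hfp, rfl⟩ := hp
  rw [exp_sub, hfp 1 (by simp), hfp 0 (by simp)]

theorem of_continuousOn_exp {g : ℝ → ℂ} (hg : ContinuousOn g (Icc 0 1)) :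
    HasLogVariation (fun x => exp (g x)) (g 1 - g 0) :=
  ⟨g, hg, fun _ _ => rfl, rfl⟩

theorem of_slitPlane (hc : ContinuousOn p (Icc 0 1)) (h : ∀ x ∈ Icc (0 : ℝ) 1, p x ∈ slitPlane) :
    HasLogVariation p (log (p 1) - log (p 0)) :=
  ⟨fun x => log (p x), hc.clog h, fun x hx => exp_log (slitPlane_ne_zero (h x hx)), rfl⟩

/-- Two logarithms differ by an integer multiple of `2πi`, which is constant by continuity on the
connected interval. -/
theorem unique (hp : HasLogVariation p v) (hq : HasLogVariation p w) : v = w := by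
  obtain ⟨f, hf, hfp, rfl⟩ := hp
  obtain ⟨g, hg, hgp, rfl⟩ := hq
  have key : ∀ x : Icc (0 : ℝ) 1, ∃ n : ℤ, (f x - g x) / (2 * Real.pi * I) = n := fun x => by
    obtain ⟨n, hn⟩ := exp_eq_exp_iff_exists_int.mp ((hfp x x.2).trans (hgp x x.2).symm)
    refine ⟨n, ?_⟩
    rw [hn, add_sub_cancel_left, mul_div_cancel_right₀ _ two_pi_I_ne_zero]
  choose m hm using key
  have hmc : Continuous m := by
    refine (Int.isClosedEmbedding_coe_real.isEmbedding.continuous_iff).mpr ?_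
    have : (Int.cast ∘ m : Icc (0 : ℝ) 1 → ℝ) =
        fun x : Icc (0 : ℝ) 1 => ((f x - g x) / (2 * Real.pi * I)).re :=
      funext fun x => by rw [hm x]; rfl
    rw [this]
    exact continuous_re.comp <| ((continuousOn_iff_continuous_domRestrict.mp hf).sub
      (continuousOn_iff_continuous_domRestrict.mp hg)).div_const _
  have h01 : m ⟨1, by simp⟩ = m ⟨0, by simp⟩ :=
    PreconnectedSpace.constant (Subtype.preconnectedSpace isPreconnected_Icc) hmc
  have h1 := hm ⟨1, by simp⟩
  have h0 := hm ⟨0, by simp⟩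
  rw [h01, ← h0, div_left_inj' two_pi_I_ne_zero] at h1
  linear_combination h1

/-- A segment that avoids the origin is seen from it under an angle less than `π`. -/
theorem exists_of_segment {a b : ℂ} (h : ∀ x ∈ Icc (0 : ℝ) 1, a + x * (b - a) ≠ 0) :
    ∃ v, HasLogVariation (fun x => a + x * (b - a)) v ∧ |v.im| < Real.pi := by
  have ha : a ≠ 0 := by simpa using h 0 (by simp)
  have hq : b / a ∈ slitPlane := by
    by_contra hq
    simp only [mem_slitPlane_iff, not_or, not_lt, not_not] at hq
    obtain ⟨r, hr⟩ : ∃ r : ℝ, b / a = r := ⟨(b / a).re, Complex.ext rfl (by simp [hq.2])⟩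
    have hr0 : r ≤ 0 := by simpa [hr] using hq.1
    have hb : b = r * a := by rw [← hr]; field_simp
    have hr1 : (1 - r : ℝ) ≠ 0 := by linarith
    -- With `b = r * a` and `r ≤ 0`, the segment meets the origin at this parameter.
    refine h (1 / (1 - r)) ⟨by have : 0 < 1 - r := by linarith
                               positivity, ?_⟩ ?_
    · rw [div_le_one (by linarith)]; linarith
    · have hr2 : (1 - r : ℂ) ≠ 0 := by exact_mod_cast hr1
      rw [hb]; push_cast; field_simp; ring
  have hseg : ∀ x ∈ Icc (0 : ℝ) 1, 1 + (x : ℂ) * (b / a - 1) ∈ slitPlane := fun x hx => by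
    have hx' := starConvex_one_slitPlane hq (sub_nonneg.mpr hx.2) hx.1 (by ring)
    convert hx' using 1
    simp only [real_smul]; push_cast; ring
  have hv := (of_slitPlane (p := fun x : ℝ => 1 + (x : ℂ) * (b / a - 1)) (by fun_prop) hseg)
  refine ⟨_, (hv.const_mul ha).congr fun x _ => by field_simp, ?_⟩
  simp only [ofReal_one, one_mul, add_sub_cancel, ofReal_zero, zero_mul, add_zero, log_one,
    sub_zero, log_im]
  rw [mem_slitPlane_iff_arg] at hq
  rw [abs_lt]
  exact ⟨neg_pi_lt_arg _, lt_of_le_of_ne (arg_le_pi _) hq.1⟩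

/-- A path in the closed upper half plane from a real number to its opposite makes half a turn. -/
theorem exists_of_im_nonneg (hc : ContinuousOn p (Icc 0 1))
    (hp : ∀ x ∈ Icc (0 : ℝ) 1, p x ≠ 0 ∧ 0 ≤ (p x).im) (h0 : (p 0).im = 0) (h1 : p 1 = -p 0) :
    ∃ v, HasLogVariation p v ∧ |v.im| = Real.pi := by
  -- A clockwise quarter turn carries the punctured closed upper half plane into the domain of the
  -- principal logarithm; the endpoints then have arguments `π/2` and `-π/2` in some order.
  have hs : ∀ x ∈ Icc (0 : ℝ) 1, -I * p x ∈ slitPlane := fun x hx => by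
    obtain ⟨hne, him⟩ := hp x hx
    rw [mem_slitPlane_iff]
    by_contra! hcon
    simp at hcon
    exact hne (Complex.ext hcon.2 (le_antisymm hcon.1 him))
  have hv := of_slitPlane (p := fun x => -I * p x) (by fun_prop) hs
  refine ⟨_, (hv.const_mul I_ne_zero).congr fun x _ => ?_, ?_⟩
  · linear_combination (-p x) * I_sq
  obtain ⟨r, hr⟩ : ∃ r : ℝ, p 0 = r := ⟨(p 0).re, Complex.ext rfl (by simp [h0])⟩
  have hr0 : r ≠ 0 := by
    rintro rfl
    exact (hp 0 (by simp)).1 (by simp [hr])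
  have e0 : -I * p 0 = ((-r : ℝ) : ℂ) * I := by rw [hr]; push_cast; ring
  have e1 : -I * p 1 = (r : ℂ) * I := by rw [h1, hr]; ring
  rw [sub_im, log_im, log_im, e0, e1]
  rcases hr0.lt_or_gt with h | h
  · have e2 : (r : ℂ) * I = ((-r : ℝ) : ℂ) * (-I) := by push_cast; ring
    rw [e2, arg_real_mul _ (by linarith), arg_real_mul _ (by linarith), arg_I, arg_neg_I]
    rw [show -(Real.pi / 2) - Real.pi / 2 = -Real.pi by ring, abs_neg, abs_of_pos Real.pi_pos]
  · have e2 : ((-r : ℝ) : ℂ) * I = (r : ℂ) * (-I) := by push_cast; ring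
    rw [e2, arg_real_mul _ h, arg_real_mul _ h, arg_I, arg_neg_I]
    rw [show Real.pi / 2 - -(Real.pi / 2) = Real.pi by ring, abs_of_pos Real.pi_pos]

end HasLogVariation

/-! ### Dividing out nondegenerate zeros -/

section Factor

variable {X : Type*} [NormedAddCommGroup X] [NormedSpace ℝ X] [FiniteDimensional ℝ X]

/-- An injective linear map in finite dimension is bounded below, so the remainder `o(x - z)` is
also `o(L (x - z))`. -/
theorem HasFDerivAt.tendsto_div_one {F : X → ℂ} {L : X →L[ℝ] ℂ} {z : X} (h : HasFDerivAt F L z)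
    (hL : Function.Injective L) (hz : F z = 0) :
    Tendsto (fun x => F x / L (x - z)) (𝓝[≠] z) (𝓝 1) := by
  obtain ⟨C, -, hC⟩ := L.toLinearMap.exists_antilipschitzWith (LinearMap.ker_eq_bot.mpr hL)
  have hne : ∀ᶠ x in 𝓝[≠] z, L (x - z) ≠ 0 := by
    filter_upwards [self_mem_nhdsWithin] with x hx h0
    exact hx (sub_eq_zero.mp (hL (h0.trans L.map_zero.symm)))
  have hO : (fun x => x - z) =O[𝓝 z] fun x => L (x - z) :=
    Asymptotics.IsBigO.of_bound C <| Eventually.of_forall fun x => by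
      simpa using hC.le_mul_dist (x - z) 0
  have he : Asymptotics.IsEquivalent (𝓝[≠] z) F fun x => L (x - z) := by
    refine Asymptotics.IsLittleO.mono ?_ nhdsWithin_le_nhds
    refine Asymptotics.IsLittleO.trans_isBigO ?_ hO
    exact h.isLittleO.congr_left fun x => by simp [hz]
  exact (Asymptotics.isEquivalent_iff_tendsto_one hne).mp he

/-- Nondegenerate zeros can be divided out by their linearizations. -/
theorem exists_continuous_factor {F : X → ℂ} (hF : Continuous F) (Z : Finset X)
    (L : X → X →L[ℝ] ℂ) (hL : ∀ z ∈ Z, Function.Injective (L z))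
    (hd : ∀ z ∈ Z, HasFDerivAt F (L z) z) (h0 : ∀ z ∈ Z, F z = 0) :
    ∃ G : X → ℂ, Continuous G ∧ (∀ z ∈ Z, G z ≠ 0) ∧ ∀ x, F x = G x * ∏ z ∈ Z, L z (x - z) := by
  classical
  have hne : ∀ z ∈ Z, ∀ x, x ≠ z → L z (x - z) ≠ 0 := fun z hz x hx h =>
    hx (sub_eq_zero.mp (hL z hz (h.trans (L z).map_zero.symm)))
  let q : X → ℂ := fun x => F x / ∏ z ∈ Z, L z (x - z)
  let e : X → X → ℂ := fun z x => (∏ y ∈ Z.erase z, L y (x - y))⁻¹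
  have hprod : ∀ x ∉ Z, ∏ z ∈ Z, L z (x - z) ≠ 0 := fun x hx =>
    Finset.prod_ne_zero_iff.mpr fun z hz => hne z hz x (by rintro rfl; exact hx hz)
  have hprod' : ∀ z ∈ Z, ∏ y ∈ Z.erase z, L y (z - y) ≠ 0 := fun z hz =>
    Finset.prod_ne_zero_iff.mpr fun y hy =>
      hne y (Finset.mem_of_mem_erase hy) z (Finset.ne_of_mem_erase hy).symm
  have hpc : ∀ s : Finset X, Continuous fun x => ∏ z ∈ s, L z (x - z) := fun s =>
    continuous_finsetProd s fun z _ => (L z).continuous.comp (continuous_id.sub continuous_const)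
  have hout : ∀ x, ∀ s : Finset X, x ∉ s → ∀ᶠ y in 𝓝 x, y ∉ s := fun x s hx =>
    s.finite_toSet.isClosed.isOpen_compl.mem_nhds (by simpa using hx)
  -- At a zero the quotient by its own linear factor tends to `1`, so the limit of `q` is the
  -- inverse of the product of the other factors.
  refine ⟨fun x => if x ∈ Z then e x x else q x, ?_, fun z hz => ?_, fun x => ?_⟩
  · rw [continuous_iff_continuousAt]
    intro x
    by_cases hx : x ∈ Z
    · rw [continuousAt_iff_punctured_nhds]
      have h1 : Tendsto (fun y => F y / L x (y - x) * e x y) (𝓝[≠] x) (𝓝 (1 * e x x)) := by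
        refine ((hd x hx).tendsto_div_one (hL x hx) (h0 x hx)).mul ?_
        exact (((hpc _).continuousAt).inv₀ (hprod' x hx)).tendsto.mono_left nhdsWithin_le_nhds
      simp only [hx, if_true]
      rw [one_mul] at h1
      refine h1.congr' ?_
      filter_upwards [self_mem_nhdsWithin,
        nhdsWithin_le_nhds (hout x (Z.erase x) (Finset.notMem_erase x Z))] with y hy hy'
      have hyZ : y ∉ Z := fun h => hy' (Finset.mem_erase.mpr ⟨hy, h⟩)
      simp only [hyZ, if_false, e, q]
      rw [← Finset.mul_prod_erase Z _ hx, div_mul_eq_div_div, div_eq_mul_inv (_ / _)]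
    · have h1 : ContinuousAt q x := hF.continuousAt.div (hpc Z).continuousAt (hprod x hx)
      refine h1.congr ?_
      filter_upwards [hout x Z hx] with y hy
      simp [hy]
  · simpa [hz, e] using hprod' z hz
  · by_cases hx : x ∈ Z
    · rw [h0 x hx, Finset.prod_eq_zero hx (by simp), mul_zero]
    · simp only [hx, if_false, q]
      rw [div_mul_cancel₀ _ (hprod x hx)]

end Factor

/-! ### The secant map -/

namespace SmoothClosedCurve

/-- The mean velocity of `S` between the parameters `s` and `s + u`. -/
noncomputable def meanVelocity (S : SmoothClosedCurve) (s u : ℝ) : ℂ :=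
  ∫ x in (0 : ℝ)..1, deriv S (s + x * u)

theorem continuous_deriv (S : SmoothClosedCurve) : Continuous (deriv S) :=
  S.contDiff.continuous_deriv le_rfl

theorem hasDerivAt (S : SmoothClosedCurve) (t : ℝ) : HasDerivAt S (deriv S t) t :=
  (S.contDiff.differentiable one_ne_zero t).hasDerivAt

theorem continuous_meanVelocity (S : SmoothClosedCurve) :
    Continuous fun z : ℝ × ℝ => S.meanVelocity z.1 z.2 := by
  apply intervalIntegral.continuous_parametric_intervalIntegral_of_continuous'
  have := S.continuous_deriv
  fun_prop

theorem meanVelocity_zero (S : SmoothClosedCurve) (s : ℝ) : S.meanVelocity s 0 = deriv S s := by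
  simp [meanVelocity]

theorem mul_meanVelocity (S : SmoothClosedCurve) (s u : ℝ) :
    u * S.meanVelocity s u = S (s + u) - S s := by
  have hd : ∀ x ∈ uIcc (0 : ℝ) 1, HasDerivAt (fun x => S (s + x * u)) (u * deriv S (s + x * u)) x :=
    fun x _ => by
      have := (S.hasDerivAt (s + x * u)).scomp x (((hasDerivAt_id x).mul_const u).const_add s)
      simpa [Function.comp_def] using this
  have hc : Continuous fun x : ℝ => (u : ℂ) * deriv S (s + x * u) := by
    have := S.continuous_deriv
    fun_prop
  have := intervalIntegral.integral_eq_sub_of_hasDerivAt hd (hc.intervalIntegrable 0 1)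
  rw [meanVelocity, ← intervalIntegral.integral_const_mul, this]
  simp

/-- The secant from `S s` to `S (s + u)`, scaled so as to extend by the tangents to `u = 0`
and `u = 1`. -/
noncomputable def secant (S : SmoothClosedCurve) (z : ℝ × ℝ) : ℂ :=
  S.meanVelocity z.1 z.2 - S.meanVelocity (z.1 + 1) (z.2 - 1)

theorem continuous_secant (S : SmoothClosedCurve) : Continuous S.secant := by
  refine S.continuous_meanVelocity.sub ?_
  exact S.continuous_meanVelocity.comp (f := fun z : ℝ × ℝ => (z.1 + 1, z.2 - 1)) (by fun_prop)

/-- By periodicity the two mean velocities are the same chord divided by `u` and by `u - 1`, and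
`1/u + 1/(1 - u) = 1/(u * (1 - u))`. -/
theorem mul_secant (S : SmoothClosedCurve) (s u : ℝ) :
    (u * (1 - u) : ℝ) * S.secant (s, u) = S (s + u) - S s := by
  have h1 := S.mul_meanVelocity s u
  have h2 := S.mul_meanVelocity (s + 1) (u - 1)
  rw [show s + 1 + (u - 1) = s + u by ring, S.periodic s] at h2
  push_cast at h2 ⊢
  rw [secant]
  linear_combination (1 - (u : ℂ)) * h1 + u * h2

theorem secant_zero (S : SmoothClosedCurve) (s : ℝ) : S.secant (s, 0) = deriv S s := by
  have h2 := S.mul_meanVelocity (s + 1) (-1)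
  simp only [secant, meanVelocity_zero, zero_sub]
  rw [show s + 1 + -1 = s by ring, S.periodic s] at h2
  push_cast at h2
  linear_combination h2

theorem secant_one (S : SmoothClosedCurve) (s : ℝ) : S.secant (s, 1) = -deriv S s := by
  have h1 := S.mul_meanVelocity s 1
  simp only [secant, sub_self, meanVelocity_zero, S.deriv_periodic s]
  rw [S.periodic s] at h1
  push_cast at h1
  linear_combination h1

/-- Exchanging the ends of a chord reverses it. This relates the slanted side of the triangle to the
vertical one. -/
theorem secant_symm (S : SmoothClosedCurve) (s u : ℝ) :
    S.secant (s + u, 1 - u) = -S.secant (s, u) := by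
  rcases eq_or_ne u 0 with rfl | h0
  · simp [secant_zero, secant_one]
  rcases eq_or_ne u 1 with rfl | h1
  · simp [secant_zero, secant_one, S.deriv_periodic s]
  have hne : ((u * (1 - u) : ℝ) : ℂ) ≠ 0 := by
    exact_mod_cast mul_ne_zero h0 (sub_ne_zero.mpr h1.symm)
  refine mul_left_cancel₀ hne ?_
  have e1 := S.mul_secant s u
  have e2 := S.mul_secant (s + u) (1 - u)
  rw [show s + u + (1 - u) = s + 1 by ring, S.periodic s] at e2
  push_cast at e1 e2 ⊢
  linear_combination e1 + e2

theorem secant_eq_zero_iff (S : SmoothClosedCurve) {s u : ℝ} (hu : u ∈ Icc (0 : ℝ) 1) :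
    S.secant (s, u) = 0 ↔ u ∈ Ioo (0 : ℝ) 1 ∧ S (s + u) = S s := by
  have e := S.mul_secant s u
  constructor
  · intro h
    refine ⟨⟨hu.1.lt_of_ne ?_, hu.2.lt_of_ne ?_⟩, ?_⟩
    · rintro rfl
      exact S.deriv_ne_zero s (by rw [← secant_zero, h])
    · rintro rfl
      exact S.deriv_ne_zero s (by rw [← neg_eq_zero, ← secant_one, h])
    · rw [h, mul_zero] at e
      exact (sub_eq_zero.mp e.symm)
  · rintro ⟨⟨h0, h1⟩, h⟩
    rw [h, sub_self, mul_eq_zero] at e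
    refine e.resolve_left ?_
    exact_mod_cast (mul_pos h0 (sub_pos.mpr h1)).ne'

/-- Where the chord vanishes, the derivative of the quotient is a nonzero multiple of the derivative
`N` of the chord, and `N` is injective by independence of the two tangents. -/
theorem exists_hasFDerivAt_secant (S : SmoothClosedCurve) {s u : ℝ} (hu : u ∈ Ioo (0 : ℝ) 1)
    (h : S (s + u) = S s) (hli : LinearIndependent ℝ ![deriv S s, deriv S (s + u)]) :
    ∃ L : ℝ × ℝ →L[ℝ] ℂ, Function.Injective L ∧ HasFDerivAt S.secant L (s, u) := by
  let N : ℝ × ℝ →L[ℝ] ℂ :=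
    (ContinuousLinearMap.fst ℝ ℝ ℝ + ContinuousLinearMap.snd ℝ ℝ ℝ).smulRight (deriv S (s + u)) -
      (ContinuousLinearMap.fst ℝ ℝ ℝ).smulRight (deriv S s)
  have hN : HasFDerivAt (fun z : ℝ × ℝ => S (z.1 + z.2) - S z.1) N (s, u) := by
    have h1 : HasFDerivAt (fun z : ℝ × ℝ => z.1 + z.2)
        (ContinuousLinearMap.fst ℝ ℝ ℝ + ContinuousLinearMap.snd ℝ ℝ ℝ) (s, u) :=
      hasFDerivAt_fst.add hasFDerivAt_snd
    have h2 : HasFDerivAt (fun z : ℝ × ℝ => z.1) (ContinuousLinearMap.fst ℝ ℝ ℝ) (s, u) := hasFDerivAt_fst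
    have e1 := (S.hasDerivAt (s + u)).hasFDerivAt.comp (s, u) h1
    have e2 := (S.hasDerivAt s).hasFDerivAt.comp (s, u) h2
    refine (e1.sub e2).congr_fderiv ?_
    ext <;> simp [N]
  have hNi : Function.Injective N := by
    rw [injective_iff_map_eq_zero]
    rintro ⟨a, b⟩ hab
    have hab' : (-a) • deriv S s + (a + b) • deriv S (s + u) = 0 := by
      rw [← hab]
      simp [N]
      ring
    obtain ⟨ha, hb⟩ := LinearIndependent.pair_iff.mp hli _ _ hab'
    have ha' : a = 0 := by linarith
    exact Prod.ext ha' (by simp only [Prod.snd_zero]; linarith)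
  have hc0 : u * (1 - u) ≠ 0 := (mul_pos hu.1 (sub_pos.mpr hu.2)).ne'
  have hcd : DifferentiableAt ℝ (fun z : ℝ × ℝ => (z.2 * (1 - z.2))⁻¹) (s, u) := by
    refine DifferentiableAt.inv (by fun_prop) hc0
  refine ⟨(u * (1 - u))⁻¹ • N, ?_, ?_⟩
  · intro a b hab
    exact hNi (smul_right_injective ℂ (inv_ne_zero hc0) hab)
  · have hq := hcd.hasFDerivAt.fun_smul hN
    simp only [h, sub_self, ContinuousLinearMap.smulRight_zero, add_zero] at hq
    refine hq.congr_of_eventuallyEq ?_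
    have : ∀ᶠ z : ℝ × ℝ in 𝓝 (s, u), z.2 * (1 - z.2) ≠ 0 :=
      ContinuousAt.eventually_ne (g := fun z : ℝ × ℝ => z.2 * (1 - z.2)) (by fun_prop) hc0
    filter_upwards [this] with z hz
    rw [← S.mul_secant, ← real_smul, inv_smul_smul₀ hz]

end SmoothClosedCurve

/-! ### Turns along the boundary of a triangle -/

/-- The triangle with vertices `(a, 0)`, `(a + 1, 0)` and `(a, 1)`. -/
def baseTriangle (a : ℝ) : Set (ℝ × ℝ) := {z | a ≤ z.1 ∧ 0 ≤ z.2 ∧ z.1 + z.2 ≤ a + 1}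

theorem isCompact_baseTriangle (a : ℝ) : IsCompact (baseTriangle a) := by
  refine (isCompact_Icc (a := ((a, 0) : ℝ × ℝ)) (b := (a + 1, 1))).of_isClosed_subset ?_ ?_
  · exact (isClosed_le continuous_const continuous_fst).inter
      ((isClosed_le continuous_const continuous_snd).inter
        (isClosed_le (continuous_fst.add continuous_snd) continuous_const))
  · rintro ⟨x, y⟩ ⟨h1, h2, h3⟩
    simp only at h1 h2 h3
    exact ⟨⟨h1, h2⟩, ⟨by simp only; linarith, by simp only; linarith⟩⟩

/-- A continuous function without zeros on a triangle has a continuous logarithm there. -/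
theorem exists_log_on_baseTriangle {G : ℝ × ℝ → ℂ} (hG : Continuous G) (a : ℝ)
    (h0 : ∀ z ∈ baseTriangle a, G z ≠ 0) :
    ∃ g : ℝ × ℝ → ℂ, Continuous g ∧ ∀ z ∈ baseTriangle a, exp (g z) = G z := by
  -- A retraction of the plane onto the triangle; `G ∘ r` has no zeros on the simply connected
  -- plane.
  let r : ℝ × ℝ → ℝ × ℝ := fun z =>
    (max a (min z.1 (a + 1)), max 0 (min z.2 (a + 1 - max a (min z.1 (a + 1)))))
  have hr : Continuous r := by fun_prop
  have hrK : ∀ z, r z ∈ baseTriangle a := fun z => by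
    have h1 : max a (min z.1 (a + 1)) ≤ a + 1 := max_le (by linarith) (min_le_right _ _)
    have h2 : (r z).2 ≤ a + 1 - (r z).1 := max_le (by simp only [r]; linarith) (min_le_right _ _)
    exact ⟨le_max_left _ _, le_max_left _ _, by linarith⟩
  have hrid : ∀ z ∈ baseTriangle a, r z = z := by
    rintro ⟨x, y⟩ ⟨h1, h2, h3⟩
    simp only at h1 h2 h3
    have e1 : max a (min x (a + 1)) = x := by
      rw [min_eq_left (by linarith), max_eq_right h1]
    simp only [r, e1]
    rw [min_eq_left (by linarith), max_eq_right h2]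
  obtain ⟨g, hg, hge⟩ := exists_continuousOn_eqOn_exp_comp (X := ℝ × ℝ) (U := univ)
    ((Homeomorph.Set.univ (ℝ × ℝ)).toHomotopyEquiv.simplyConnectedSpace_iff.mpr inferInstance)
    isOpen_univ (hG.comp hr).continuousOn (by rintro ⟨z, -, hz⟩; exact h0 _ (hrK z) hz)
  refine ⟨g, continuousOn_univ.mp hg, fun z hz => ?_⟩
  have := hge (mem_univ z)
  simpa [hrid z hz] using this

/-- `n` is the number of turns of `F` along the boundary of the triangle. -/
def HasBoundaryTurns (F : ℝ × ℝ → ℂ) (a : ℝ) (n : ℤ) : Prop :=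
  ∃ v₁ v₂ v₃ : ℂ, HasLogVariation (fun x => F (a + x, 0)) v₁ ∧
    HasLogVariation (fun x => F (a, x)) v₂ ∧ HasLogVariation (fun x => F (a + x, 1 - x)) v₃ ∧
    v₁ - v₂ - v₃ = n * (2 * Real.pi * I)

theorem mem_baseTriangle_sides (a : ℝ) {x : ℝ} (hx : x ∈ Icc (0 : ℝ) 1) :
    (a + x, (0 : ℝ)) ∈ baseTriangle a ∧ (a, x) ∈ baseTriangle a ∧
      (a + x, 1 - x) ∈ baseTriangle a := by
  obtain ⟨h0, h1⟩ := hx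
  simp only [baseTriangle, mem_ofPred_eq]
  refine ⟨⟨?_, ?_, ?_⟩, ⟨?_, ?_, ?_⟩, ⟨?_, ?_, ?_⟩⟩ <;> linarith

namespace HasBoundaryTurns

variable {F G : ℝ × ℝ → ℂ} {a : ℝ} {m n : ℤ}

theorem congr (hF : HasBoundaryTurns F a n) (h : ∀ z ∈ baseTriangle a, F z = G z) :
    HasBoundaryTurns G a n := by
  obtain ⟨v₁, v₂, v₃, h₁, h₂, h₃, e⟩ := hF
  exact ⟨v₁, v₂, v₃, h₁.congr fun x hx => h _ (mem_baseTriangle_sides a hx).1,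
    h₂.congr fun x hx => h _ (mem_baseTriangle_sides a hx).2.1,
    h₃.congr fun x hx => h _ (mem_baseTriangle_sides a hx).2.2, e⟩

theorem mul (hF : HasBoundaryTurns F a m) (hG : HasBoundaryTurns G a n) :
    HasBoundaryTurns (fun z => F z * G z) a (m + n) := by
  obtain ⟨v₁, v₂, v₃, h₁, h₂, h₃, e⟩ := hF
  obtain ⟨w₁, w₂, w₃, k₁, k₂, k₃, e'⟩ := hG
  refine ⟨_, _, _, h₁.mul k₁, h₂.mul k₂, h₃.mul k₃, ?_⟩
  push_cast
  linear_combination e + e'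

theorem exp {g : ℝ × ℝ → ℂ} (hg : Continuous g) (a : ℝ) :
    HasBoundaryTurns (fun z => Complex.exp (g z)) a 0 := by
  refine ⟨_, _, _,
    HasLogVariation.of_continuousOn_exp (g := fun x => g (a + x, 0)) (by fun_prop),
    HasLogVariation.of_continuousOn_exp (g := fun x => g (a, x)) (by fun_prop),
    HasLogVariation.of_continuousOn_exp (g := fun x => g (a + x, 1 - x)) (by fun_prop), ?_⟩
  simp

theorem exists_prod {ι : Type*} (s : Finset ι) {F : ι → ℝ × ℝ → ℂ}
    (h : ∀ i ∈ s, ∃ n : ℤ, |n| ≤ 1 ∧ HasBoundaryTurns (F i) a n) :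
    ∃ n : ℤ, |n| ≤ s.card ∧ HasBoundaryTurns (fun z => ∏ i ∈ s, F i z) a n := by
  classical
  induction s using Finset.induction_on with
  | empty => exact ⟨0, by simp, by simpa using exp (g := fun _ => 0) continuous_const a⟩
  | insert i s hi ih =>
    obtain ⟨m, hm, hFm⟩ := h i (Finset.mem_insert_self i s)
    obtain ⟨n, hn, hFn⟩ := ih fun j hj => h j (Finset.mem_insert_of_mem hj)
    simp only [Finset.prod_insert hi, Finset.card_insert_of_notMem hi]
    refine ⟨m + n, ?_, hFm.mul hFn⟩
    push_cast
    linarith [abs_add_le m n]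

/-- Each side is mapped to a segment missing the origin, so the total angle is below `3π` in
absolute value; being a multiple of `2π`, it is at most one turn. -/
theorem exists_of_linear {L : ℝ × ℝ →L[ℝ] ℂ} (hL : Function.Injective L) {z : ℝ × ℝ}
    (h1 : a < z.1) (h2 : 0 < z.2) (h3 : z.1 + z.2 < a + 1) :
    ∃ n : ℤ, |n| ≤ 1 ∧ HasBoundaryTurns (fun x => L (x - z)) a n := by
  have side : ∀ p q : ℝ × ℝ, (∀ x ∈ Icc (0 : ℝ) 1, p + x • (q - p) ≠ z) →
      ∃ v, HasLogVariation (fun x => L (p + x • (q - p) - z)) v ∧ |v.im| < Real.pi := by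
    intro p q hpq
    have e : ∀ x : ℝ, L (p + x • (q - p) - z) = L (p - z) + x * (L (q - z) - L (p - z)) :=
      fun x => by
        rw [← map_sub, ← real_smul, ← map_smul, ← map_add]
        congr 1
        module
    simp only [e]
    refine HasLogVariation.exists_of_segment fun x hx h => hpq x hx ?_
    rw [← e x] at h
    exact sub_eq_zero.mp (hL (h.trans L.map_zero.symm))
  obtain ⟨v₁, hv₁, b₁⟩ := side (a, 0) (a + 1, 0) fun x _ h => by
    have := congrArg Prod.snd h
    simp at this
    linarith
  obtain ⟨v₂, hv₂, b₂⟩ := side (a, 0) (a, 1) fun x _ h => by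
    have := congrArg Prod.fst h
    simp at this
    linarith
  obtain ⟨v₃, hv₃, b₃⟩ := side (a, 1) (a + 1, 0) fun x _ h => by
    have e1 := congrArg Prod.fst h
    have e2 := congrArg Prod.snd h
    simp at e1 e2
    linarith
  have hv₁' : HasLogVariation (fun x => L ((a + x, 0) - z)) v₁ :=
    hv₁.congr fun x _ => by simp
  have hv₂' : HasLogVariation (fun x => L ((a, x) - z)) v₂ :=
    hv₂.congr fun x _ => by simp
  have hv₃' : HasLogVariation (fun x => L ((a + x, 1 - x) - z)) v₃ :=
    hv₃.congr fun x _ => by simp [sub_eq_add_neg]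
  have hne : ∀ w : ℝ × ℝ, w ≠ z → L (w - z) ≠ 0 := fun w hw h =>
    hw (sub_eq_zero.mp (hL (h.trans L.map_zero.symm)))
  -- The endpoint quotients cancel around the triangle; the minus signs occur because the vertical
  -- and slanted sides are parametrized against the boundary orientation.
  have hexp : Complex.exp (v₁ - v₂ - v₃) = 1 := by
    rw [exp_sub, exp_sub, hv₁'.exp_eq_div, hv₂'.exp_eq_div, hv₃'.exp_eq_div]
    have n1 := hne (a, 0) (by rintro rfl; exact h1.false)
    have n2 := hne (a + 1, 0) (by rintro rfl; exact h2.false)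
    have n3 := hne (a, 1) (by rintro rfl; exact h1.false)
    simp only [add_zero, sub_zero, sub_self]
    field_simp
  obtain ⟨n, hn⟩ := exp_eq_one_iff.mp hexp
  refine ⟨n, ?_, v₁, v₂, v₃, hv₁', hv₂', hv₃', hn⟩
  have him := congrArg Complex.im hn
  simp at him
  rw [abs_lt] at b₁ b₂ b₃
  have hpi := Real.pi_pos
  have hlt : |(n : ℝ)| < 2 := by
    rw [abs_lt]
    constructor <;> nlinarith
  have : |n| < 2 := by exact_mod_cast hlt
  omega

/-- If all zeros in the triangle are interior and nondegenerate, then their number bounds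
the number of turns along the boundary. -/
theorem exists_of_nondegenerate_zeros (hF : Continuous F) (Z : Finset (ℝ × ℝ))
    (hZ : ∀ z ∈ Z, a < z.1 ∧ 0 < z.2 ∧ z.1 + z.2 < a + 1)
    (h0 : ∀ z ∈ baseTriangle a, F z = 0 ↔ z ∈ Z)
    (hd : ∀ z ∈ Z, ∃ L : ℝ × ℝ →L[ℝ] ℂ, Function.Injective L ∧ HasFDerivAt F L z) :
    ∃ n : ℤ, |n| ≤ Z.card ∧ HasBoundaryTurns F a n := by
  choose! L hLi hLd using hd
  have hZK : ∀ z ∈ Z, z ∈ baseTriangle a := fun z hz =>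
    ⟨(hZ z hz).1.le, (hZ z hz).2.1.le, (hZ z hz).2.2.le⟩
  obtain ⟨G, hG, hGZ, hFG⟩ := exists_continuous_factor hF Z L hLi hLd
    fun z hz => (h0 z (hZK z hz)).mpr hz
  have hG0 : ∀ z ∈ baseTriangle a, G z ≠ 0 := fun z hz h => by
    by_cases hzZ : z ∈ Z
    · exact hGZ z hzZ h
    · exact hzZ ((h0 z hz).mp (by rw [hFG, h, zero_mul]))
  obtain ⟨g, hg, hgG⟩ := exists_log_on_baseTriangle hG a hG0
  obtain ⟨n, hn, hP⟩ := exists_prod (a := a) Z (F := fun z x => L z (x - z)) fun z hz =>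
    exists_of_linear (hLi z hz) (hZ z hz).1 (hZ z hz).2.1 (hZ z hz).2.2
  refine ⟨0 + n, by simpa using hn, ((exp hg a).mul hP).congr fun z hz => ?_⟩
  rw [hgG z hz, hFG z]

end HasBoundaryTurns

/-! ### Self-intersections as zeros of the secant -/

theorem Function.Periodic.apply_fract {f : ℝ → ℂ} (hf : Function.Periodic f 1) (t : ℝ) :
    f (Int.fract t) = f t := by
  rw [Int.fract, ← zsmul_one, hf.sub_zsmul_eq]

theorem Int.fract_ne_fract_of_lt {s t : ℝ} (h1 : s < t) (h2 : t < s + 1) :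
    Int.fract s ≠ Int.fract t := by
  rw [Ne, Int.fract_eq_fract]
  rintro ⟨n, hn⟩
  have a1 : (n : ℝ) < 0 := by linarith
  have a2 : (-1 : ℝ) < n := by linarith
  have a3 : n < 0 := by exact_mod_cast a1
  have a4 : -1 < n := by exact_mod_cast a2
  omega

namespace SmoothClosedCurve

variable {S : SmoothClosedCurve}

theorem IsNormal.linearIndependent (hS : S.IsNormal) {s u : ℝ} (hu : u ∈ Ioo (0 : ℝ) 1)
    (h : S (s + u) = S s) : LinearIndependent ℝ ![deriv S s, deriv S (s + u)] := by
  have hne := Int.fract_ne_fract_of_lt (s := s) (t := s + u) (by linarith [hu.1])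
    (by linarith [hu.2])
  have := hS.transverse _ ⟨Int.fract_nonneg s, Int.fract_lt_one s⟩ _
    ⟨Int.fract_nonneg (s + u), Int.fract_lt_one (s + u)⟩ hne
    (by rw [S.periodic.apply_fract, S.periodic.apply_fract, h])
  rwa [S.deriv_periodic.apply_fract, S.deriv_periodic.apply_fract] at this

/-- Allows the period to start at the lowest point: the increment in full turns is continuous and
integral, hence independent of `t`. -/
theorem IsTangentAngle.add_one_sub {θ : ℝ → ℝ} (h : S.IsTangentAngle θ) (t : ℝ) :
    θ (t + 1) - θ t = 2 * Real.pi * S.rotationNumber := by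
  have key : ∀ t, ∃ m : ℤ, (θ (t + 1) - θ t) / (2 * Real.pi) = m := fun t => by
    obtain ⟨m, hm⟩ := h.exp_eq h (S.deriv_periodic t)
    exact ⟨m, by rw [hm]; field_simp⟩
  choose m hm using key
  have hθ := h.1
  have hmc : Continuous m := by
    refine (Int.isClosedEmbedding_coe_real.isEmbedding.continuous_iff).mpr ?_
    have : (Int.cast ∘ m : ℝ → ℝ) = fun t => (θ (t + 1) - θ t) / (2 * Real.pi) :=
      funext fun t => (hm t).symm
    rw [this]
    fun_prop
  have h1 := hm t
  rw [PreconnectedSpace.constant inferInstance hmc (y := 0), ← hm 0, zero_add, h.sub_eq] at h1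
  field_simp at h1
  linarith

theorem exists_forall_im_le (S : SmoothClosedCurve) : ∃ a, ∀ t, (S a).im ≤ (S t).im := by
  have hc : Continuous fun t => (S t).im := continuous_im.comp S.contDiff.continuous
  obtain ⟨a, -, ha⟩ := (isCompact_Icc (a := (0 : ℝ)) (b := 1)).exists_isMinOn ⟨0, by simp⟩
    hc.continuousOn
  refine ⟨a, fun t => ?_⟩
  rw [← S.periodic.apply_fract t]
  exact ha ⟨Int.fract_nonneg t, (Int.fract_lt_one t).le⟩

theorem deriv_im_eq_zero {a : ℝ} (ha : ∀ t, (S a).im ≤ (S t).im) : (deriv S a).im = 0 := by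
  have hd : HasDerivAt (fun t => (S t).im) (deriv S a).im a := by
    exact imCLM.hasFDerivAt.comp_hasDerivAt a (S.hasDerivAt a)
  exact IsLocalMin.hasDerivAt_eq_zero (Eventually.of_forall ha) hd

/-- The parameter pairs, relative to the base point `a`, of the self-intersections. -/
def doubleParams (S : SmoothClosedCurve) (a : ℝ) : Set (ℝ × ℝ) :=
  {z | z ∈ baseTriangle a ∧ S.secant z = 0}

/-- Two branches through a lowest point would both be horizontal there, against transversality. -/
theorem secant_base_ne_zero (hS : S.IsNormal) {a : ℝ} (ha : ∀ t, (S a).im ≤ (S t).im) {x : ℝ}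
    (hx : x ∈ Icc (0 : ℝ) 1) : S.secant (a, x) ≠ 0 := by
  rw [Ne, S.secant_eq_zero_iff hx]
  rintro ⟨hx', h⟩
  have h1 := deriv_im_eq_zero ha
  have h2 := deriv_im_eq_zero (S := S) (a := a + x) (by rw [h]; exact ha)
  have hz := LinearIndependent.pair_iff.mp (hS.linearIndependent hx' h)
    (deriv S (a + x)).re (-(deriv S a).re)
    (Complex.ext (by simp; ring) (by simp [h1, h2]))
  exact S.deriv_ne_zero (a + x) (Complex.ext hz.1 h2)

theorem interior_of_mem_doubleParams (hS : S.IsNormal) {a : ℝ} (ha : ∀ t, (S a).im ≤ (S t).im)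
    {z : ℝ × ℝ} (hz : z ∈ S.doubleParams a) :
    (a < z.1 ∧ 0 < z.2 ∧ z.1 + z.2 < a + 1) ∧ z.2 ∈ Ioo (0 : ℝ) 1 ∧ S (z.1 + z.2) = S z.1 := by
  obtain ⟨s, u⟩ := z
  obtain ⟨⟨h1, h2, h3⟩, h0⟩ := hz
  simp only at h1 h2 h3 ⊢
  have hu : u ∈ Icc (0 : ℝ) 1 := ⟨h2, by linarith⟩
  obtain ⟨hu', h⟩ := (S.secant_eq_zero_iff hu).mp h0
  refine ⟨⟨h1.lt_of_ne ?_, hu'.1, h3.lt_of_ne fun h4 => ?_⟩, hu', h⟩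
  · rintro rfl
    exact secant_base_ne_zero hS ha hu h0
  -- By symmetry, a zero on the slanted side would give one on the vertical side.
  · refine secant_base_ne_zero hS ha (x := s - a) ⟨by linarith, by linarith⟩ ?_
    rw [← neg_eq_zero, ← S.secant_symm, ← h0]
    congr 2 <;> linarith

theorem exists_hasFDerivAt_of_mem_doubleParams (hS : S.IsNormal) {a : ℝ}
    (ha : ∀ t, (S a).im ≤ (S t).im) {z : ℝ × ℝ} (hz : z ∈ S.doubleParams a) :
    ∃ L : ℝ × ℝ →L[ℝ] ℂ, Function.Injective L ∧ HasFDerivAt S.secant L z := by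
  obtain ⟨-, hu, h⟩ := interior_of_mem_doubleParams hS ha hz
  exact S.exists_hasFDerivAt_secant hu h (hS.linearIndependent hu h)

/-- An infinite closed set in the compact triangle would accumulate at one of its points, but a zero
with injective derivative is isolated. -/
theorem finite_doubleParams (hS : S.IsNormal) {a : ℝ} (ha : ∀ t, (S a).im ≤ (S t).im) :
    (S.doubleParams a).Finite := by
  by_contra hinf
  have hcl : IsClosed (S.doubleParams a) := (isCompact_baseTriangle a).isClosed.inter
    (isClosed_singleton.preimage S.continuous_secant)
  obtain ⟨z, -, hz⟩ := Set.Infinite.exists_accPt_of_subset_isCompact hinf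
    (isCompact_baseTriangle a) fun z hz => hz.1
  have hzm : z ∈ S.doubleParams a := by
    rw [← hcl.closure_eq]
    exact mem_closure_iff_clusterPt.mpr hz.clusterPt
  obtain ⟨L, hL, hd⟩ := exists_hasFDerivAt_of_mem_doubleParams hS ha hzm
  obtain ⟨C, -, hC⟩ := L.toLinearMap.exists_antilipschitzWith (LinearMap.ker_eq_bot.mpr hL)
  obtain ⟨y, hy, hy0⟩ :=
    ((accPt_iff_frequently_nhdsNE.mp hz).and_eventually (hd.eventually_ne (c := 0) ⟨C, hC⟩)).exists
  exact hy0 hy.2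

theorem image_doubleParams (S : SmoothClosedCurve) (hS : S.IsNormal) {a : ℝ}
    (ha : ∀ t, (S a).im ≤ (S t).im) :
    (fun z : ℝ × ℝ => S z.1) '' S.doubleParams a = S.selfIntersections := by
  ext p
  constructor
  · rintro ⟨⟨s, u⟩, hz, rfl⟩
    obtain ⟨-, hu, h⟩ := interior_of_mem_doubleParams hS ha hz
    simp only at hu h ⊢
    exact ⟨Int.fract s, ⟨Int.fract_nonneg s, Int.fract_lt_one s⟩, Int.fract (s + u),
      ⟨Int.fract_nonneg _, Int.fract_lt_one _⟩,
      Int.fract_ne_fract_of_lt (by linarith [hu.1]) (by linarith [hu.2]),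
      S.periodic.apply_fract _, (S.periodic.apply_fract _).trans h⟩
  · rintro ⟨s, hs, t, ht, hst, hsp, htp⟩
    have key : ∀ s t : ℝ, s ∈ Ico a (a + 1) → t ∈ Ico a (a + 1) → s < t → S s = p → S t = p →
        p ∈ (fun z : ℝ × ℝ => S z.1) '' S.doubleParams a := by
      intro s t hs ht hst hsp htp
      refine ⟨(s, t - s), ⟨⟨hs.1, by simp only; linarith, by simp only; linarith [ht.2]⟩, ?_⟩, hsp⟩
      rw [S.secant_eq_zero_iff ⟨by linarith, by linarith [hs.1, ht.2]⟩]
      exact ⟨⟨by linarith, by linarith [hs.1, ht.2]⟩, by rw [add_sub_cancel, hsp, htp]⟩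
    have lift : ∀ s ∈ Ico (0 : ℝ) 1, ∃ s' ∈ Ico a (a + 1), Int.fract s' = s := fun s hs => by
      refine ⟨a + Int.fract (s - a), ⟨by linarith [Int.fract_nonneg (s - a)],
        by linarith [Int.fract_lt_one (s - a)]⟩, ?_⟩
      nth_rw 2 [← Int.fract_eq_self.mpr hs]
      rw [Int.fract_eq_fract]
      exact ⟨-⌊s - a⌋, by rw [Int.fract]; push_cast; ring⟩
    obtain ⟨s', hs', rfl⟩ := lift s hs
    obtain ⟨t', ht', rfl⟩ := lift t ht
    rw [S.periodic.apply_fract] at hsp htp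
    rcases lt_trichotomy s' t' with h | h | h
    · exact key s' t' hs' ht' h hsp htp
    · exact absurd (congrArg _ h) hst
    · exact key t' s' ht' hs' h htp hsp

/-- Without triple points, two parameter pairs over the same point have the same two members, and `u
> 0` fixes their order. -/
theorem injOn_doubleParams (hS : S.IsNormal) {a : ℝ} (ha : ∀ t, (S a).im ≤ (S t).im) :
    InjOn (fun z : ℝ × ℝ => S z.1) (S.doubleParams a) := by
  have fr : ∀ s t : ℝ, a < s → s < a + 1 → a < t → t < a + 1 →
      Int.fract s = Int.fract t → s = t := by
    intro s t h1 h2 h3 h4 h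
    rcases lt_trichotomy s t with hlt | heq | hlt
    · exact absurd h (Int.fract_ne_fract_of_lt hlt (by linarith))
    · exact heq
    · exact absurd h.symm (Int.fract_ne_fract_of_lt hlt (by linarith))
  have tri : ∀ s t u : ℝ, s ∈ Ioo a (a + 1) → t ∈ Ioo a (a + 1) → u ∈ Ioo a (a + 1) →
      S s = S t → S t = S u → s = t ∨ t = u ∨ s = u := by
    intro s t u hs ht hu hst htu
    have := hS.no_triple (Int.fract s) ⟨Int.fract_nonneg _, Int.fract_lt_one _⟩
      (Int.fract t) ⟨Int.fract_nonneg _, Int.fract_lt_one _⟩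
      (Int.fract u) ⟨Int.fract_nonneg _, Int.fract_lt_one _⟩
      (by simpa only [S.periodic.apply_fract] using hst)
      (by simpa only [S.periodic.apply_fract] using htu)
    exact this.imp (fr s t hs.1 hs.2 ht.1 ht.2)
      (Or.imp (fr t u ht.1 ht.2 hu.1 hu.2) (fr s u hs.1 hs.2 hu.1 hu.2))
  rintro ⟨s, u⟩ hz ⟨s', u'⟩ hz' h
  obtain ⟨⟨a1, a2, a3⟩, -, e⟩ := interior_of_mem_doubleParams hS ha hz
  obtain ⟨⟨b1, b2, b3⟩, -, e'⟩ := interior_of_mem_doubleParams hS ha hz'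
  simp only at a1 a2 a3 b1 b2 b3 e e' h
  have m1 : s ∈ Ioo a (a + 1) := ⟨a1, by linarith⟩
  have m2 : s + u ∈ Ioo a (a + 1) := ⟨by linarith, a3⟩
  have m3 : s' ∈ Ioo a (a + 1) := ⟨b1, by linarith⟩
  have m4 : s' + u' ∈ Ioo a (a + 1) := ⟨by linarith, b3⟩
  have t1 := tri s (s + u) s' m1 m2 m3 e.symm (e.trans h)
  have t2 := tri s (s + u) (s' + u') m1 m2 m4 e.symm (e.trans (h.trans e'.symm))
  have q1 : s ≠ s + u := by linarith
  have q2 : s' ≠ s' + u' := by linarith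
  rw [Prod.mk.injEq]
  rcases t1 with t1 | t1 | t1
  · exact absurd t1 q1
  · rcases t2 with t2 | t2 | t2
    · exact absurd t2 q1
    · exact absurd (t1.symm.trans t2) q2
    · linarith
  · rcases t2 with t2 | t2 | t2
    · exact absurd t2 q1
    · exact ⟨t1, by linarith⟩
    · exact absurd (t1.symm.trans t2) q2

/-! ### Comparison with the rotation number -/

/-- The rotation number differs by one from the number of turns of the secant along the boundary
of the parameter triangle, if the base point is a lowest point of the curve. -/
theorem rotationNumber_of_hasBoundaryTurns {a : ℝ} (hS : S.IsNormal)
    (ha : ∀ t, (S a).im ≤ (S t).im) {n : ℤ} (hn : HasBoundaryTurns S.secant a n) :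
    S.rotationNumber = n + 1 ∨ S.rotationNumber = n - 1 := by
  obtain ⟨v₁, v₂, v₃, h₁, h₂, h₃, e⟩ := hn
  obtain ⟨θ, hθ⟩ := S.exists_isTangentAngle
  have hc := S.continuous_secant
  have hdc := S.continuous_deriv
  have hθc := hθ.1
  have hnorm : ∀ t, ‖deriv S t‖ ≠ 0 := fun t => norm_ne_zero_iff.mpr (S.deriv_ne_zero t)
  have hd : HasLogVariation (fun x => S.secant (a + x, 0)) ((2 * Real.pi * S.rotationNumber) * I) := by
    refine ⟨fun x => (Real.log ‖deriv S (a + x)‖ : ℂ) + θ (a + x) * I, ?_, fun x _ => ?_, ?_⟩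
    · have : Continuous fun x => Real.log ‖deriv S (a + x)‖ :=
        Continuous.log (by fun_prop) fun x => hnorm _
      fun_prop
    · simp only [secant_zero]
      rw [exp_add, ← ofReal_exp, Real.exp_log (by have := hnorm (a + x); positivity)]
      exact (hθ.2 _).symm
    · have h := congrArg (fun r : ℝ => (r : ℂ)) (hθ.add_one_sub a)
      push_cast at h
      simp only [S.deriv_periodic a, add_zero]
      linear_combination I * h
  have h0 := deriv_im_eq_zero ha
  have hup : ∀ x ∈ Icc (0 : ℝ) 1, S.secant (a, x) ≠ 0 ∧ 0 ≤ (S.secant (a, x)).im := by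
    intro x hx
    have hne := secant_base_ne_zero hS ha hx
    refine ⟨hne, ?_⟩
    rcases eq_or_ne x 0 with rfl | hx0
    · rw [secant_zero, h0]
    rcases eq_or_ne x 1 with rfl | hx1
    · rw [secant_one, neg_im, h0, neg_zero]
    have hpos : 0 < x * (1 - x) :=
      mul_pos (hx.1.lt_of_ne hx0.symm) (sub_pos.mpr (hx.2.lt_of_ne hx1))
    have him := congrArg Complex.im (S.mul_secant a x)
    rw [im_ofReal_mul, sub_im] at him
    refine nonneg_of_mul_nonneg_right ?_ hpos
    rw [him]
    linarith [ha (a + x)]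
  obtain ⟨v, hv, hvpi⟩ := HasLogVariation.exists_of_im_nonneg
    (p := fun x => S.secant (a, x)) (by fun_prop) hup
    (by simpa [secant_zero] using h0) (by simp [secant_zero, secant_one])
  have hv3 : HasLogVariation (fun x => S.secant (a + x, 1 - x)) v :=
    (hv.const_mul (c := -1) (by simp)).congr fun x _ => by rw [secant_symm]; ring
  -- With `R` the rotation number, the imaginary parts now read `2πR - 2 * v.im = 2πn`, where `v.im
  -- = ±π`.
  rw [h₁.unique hd, h₂.unique hv, h₃.unique hv3] at e
  have him := congrArg Complex.im e
  simp at him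
  have hpi := Real.pi_pos
  rcases (abs_eq hpi.le).mp hvpi with h | h
  · left
    have : (S.rotationNumber : ℝ) = n + 1 := by
      rw [h] at him
      refine mul_left_cancel₀ (mul_pos two_pos hpi).ne' ?_
      linarith
    exact_mod_cast this
  · right
    have : (S.rotationNumber : ℝ) = n - 1 := by
      rw [h] at him
      refine mul_left_cancel₀ (mul_pos two_pos hpi).ne' ?_
      linarith
    exact_mod_cast this

end SmoothClosedCurve

end

theorem mainTheorem8 (S : SmoothClosedCurve) (hS : S.IsNormal) :
    S.selfIntersections.Finite ∧
      |(|S.rotationNumber| - 1)| ≤ (S.selfIntersections.ncard : ℤ) := by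
  obtain ⟨a, ha⟩ := S.exists_forall_im_le
  have hfin := SmoothClosedCurve.finite_doubleParams hS ha
  rw [← S.image_doubleParams hS ha]
  refine ⟨hfin.image _, ?_⟩
  rw [(SmoothClosedCurve.injOn_doubleParams hS ha).ncard_image, Set.ncard_eq_toFinset_card _ hfin]
  obtain ⟨n, hn, hturns⟩ := HasBoundaryTurns.exists_of_nondegenerate_zeros (a := a)
    S.continuous_secant hfin.toFinset
    (fun z hz => (SmoothClosedCurve.interior_of_mem_doubleParams hS ha (hfin.mem_toFinset.mp hz)).1)
    (fun z hz => by rw [hfin.mem_toFinset]; exact ⟨fun h => ⟨hz, h⟩, fun h => h.2⟩)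
    (fun z hz => SmoothClosedCurve.exists_hasFDerivAt_of_mem_doubleParams hS ha (hfin.mem_toFinset.mp hz))
  -- In both cases `||n ± 1| - 1| ≤ |n|` by the triangle inequality.
  rcases SmoothClosedCurve.rotationNumber_of_hasBoundaryTurns hS ha hturns with h | h <;> rw [h] <;> grind
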